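/- Let $k\ge 1$, $\alpha_1,\dots,\alpha_k\in(1,2)$, $l_1,\dots,l_k>0$, and let $p\in L^1([-\pi,\pi]^k)$ be a nonnegative even real function (both a.e.), with $p(\mathbf 0)=0$. Put $q(\boldsymbol\theta)=\sum_{i=1}^k l_i|\theta_i|^{\alpha_i}$ and suppose that there are constants $0<c_0<c_1$ with $$c_0\le \frac{p(\boldsymbol\theta)}{q(\boldsymbol\theta)}\le c_1\qquad\text{for a.e. }\boldsymbol\theta\in[-\pi,\pi]^k .$$ For $\mathbf n=(n_1,\dots,n_k)$ with all $n_i\ge 1$, let $B_{\mathbf n}=T_{\mathbf n}(p)=[\hat p_{\mathbf i-\mathbf j}]_{\mathbf i,\mathbf j=\mathbf 1}^{\mathbf n}$ be the $k$-level Toeplitz matrix of size $n_1\cdots n_k$ generated by $p$, where $\hat p_{\mathbf j}=(2\pi)^{-k}\int_{[-\pi,\pi]^k}p(\boldsymbol\theta)e^{\iota\langle\mathbf j,\boldsymbol\theta\rangle}d\boldsymbol\theta$ (it is real, since $p$ is even). For a symmetric Toeplitz matrix $T=[t_{|i-j|}]_{i,j=1}^n$ let $\tau(T)=T-H(T)$,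 where $H(T)$ is the $n\times n$ Hankel matrix with successive antidiagonals $t_2,\dots,t_{n-1},0,0,0,t_{n-1},\dots,t_2$ ($H(T)=0$ if $n\le 2$). Let $R_{n_i}^{(\alpha_i)}$ be the $n_i\times n_i$ Toeplitz matrix generated by $(2-2\cos\theta)^{\alpha_i/2}$, let $R_{\mathbf n}=\sum_{i=1}^k I_{n_1\cdots n_{i-1}}\otimes l_iR_{n_i}^{(\alpha_i)}\otimes I_{n_{i+1}\cdots n_k}$, and let $$\tau(R_{\mathbf n})=\sum_{i=1}^k I_{n_1\cdots n_{i-1}}\otimes l_i\,\tau\bigl(R_{n_i}^{(\alpha_i)}\bigr)\otimes I_{n_{i+1}\cdots n_k}.$$ 1. For every $\mathbf n$, the matrices $\tau(R_{\mathbf n})$ and $B_{\mathbf n}$ are symmetric positive definite, all eigenvalues of $\tau(R_{\mathbf n})^{-1}B_{\mathbf n}$ are real and positive, and the spectral condition number, i.e. the ratio of the largest to the smallest eigenvalue, satisfies $$\kappa_2\bigl(\tau(R_{\mathbf n})^{-1}B_{\mathbf n}\bigr)=\frac{\lambda_{\max}\bigl(\tau(R_{\mathbf n})^{-1}B_{\mathbf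 n}\bigr)}{\lambda_{\min}\bigl(\tau(R_{\mathbf n})^{-1}B_{\mathbf n}\bigr)}\le\frac{3\pi^2c_1}{c_0},$$ a bound independent of $\mathbf n$. 2. Consequently the number of iterations of the preconditioned conjugate gradient (PCG) method for $B_{\mathbf n}\mathbf u=\mathbf b$ with preconditioner $\tau(R_{\mathbf n})$ (in exact arithmetic) is independent of the matrix size: for every $\varepsilon>0$ there is $M\in\mathbb N$ such that, for every $\mathbf n$, every right-hand side $\mathbf b$ and every initial guess $\mathbf x_0$, the PCG iterates satisfy $$\|\mathbf x_m-\mathbf u\|_{B_{\mathbf n}}\le\varepsilon\,\|\mathbf x_0-\mathbf u\|_{B_{\mathbf n}}\qquad\text{for all } m\ge M,$$ where $\mathbf u$ is the solution and $\|\mathbf v\|_{B_{\mathbf n}}=(\mathbf v^\top B_{\mathbf n}\mathbf v)^{1/2}$. -/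

import Mathlib

open MeasureTheory

namespace TauPCG

noncomputable section

/-- The cube `[-π, π]^k`. -/
def cube (k : ℕ) : Set (Fin k → ℝ) :=
  Set.Icc (fun _ => -Real.pi) (fun _ => Real.pi)

/-- The index set `{1, …, n₁} × ⋯ × {1, …, n_k}` (shifted to start from zero) of the rows and
columns of a `k`-level matrix of size `N(n) = n₁ ⋯ n_k`. -/
abbrev MultiIdx {k : ℕ} (n : Fin k → ℕ) : Type := (i : Fin k) → Fin (n i)

/-- The Fourier coefficient `(2π)^{-k} ∫_{[-π,π]^k} f(θ) e^{ι⟨j,θ⟩} dθ`. -/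
def fourierCoef {k : ℕ} (f : (Fin k → ℝ) → ℝ) (j : Fin k → ℤ) : ℂ :=
  (1 / (2 * (Real.pi : ℂ)) ^ k) *
    ∫ θ in cube k, (f θ : ℂ) * Complex.exp (Complex.I * ((∑ t, (j t : ℝ) * θ t : ℝ) : ℂ))

/-- The `k`-level Toeplitz matrix `T_n(f)`, whose `(a, b)` entry is the Fourier coefficient of `f`
of index `a - b`. -/
def toeplitz {k : ℕ} (f : (Fin k → ℝ) → ℝ) (n : Fin k → ℕ) :
    Matrix (MultiIdx n) (MultiIdx n) ℂ :=
  Matrix.of fun a b => fourierCoef f (fun t => ((a t : ℕ) : ℤ) - ((b t : ℕ) : ℤ))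

/-- `T_n(f)` as a real matrix. For an even `f` the entries of `T_n(f)` are real, so that nothing is
lost in taking real parts: see `toeplitz_eq_map_toeplitzReal`. -/
def toeplitzReal {k : ℕ} (f : (Fin k → ℝ) → ℝ) (n : Fin k → ℕ) :
    Matrix (MultiIdx n) (MultiIdx n) ℝ :=
  (toeplitz f n).map Complex.re

/-- The Fourier coefficients of an even function are real. -/
theorem fourierCoef_im {k : ℕ} (f : (Fin k → ℝ) → ℝ)
    (hf : ∀ᵐ θ ∂(volume.restrict (cube k)), f (-θ) = f θ) (j : Fin k → ℤ) :
    (fourierCoef f j).im = 0 := by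
  have hmp : MeasurePreserving (fun θ : Fin k → ℝ => -θ) volume volume :=
    Measure.measurePreserving_neg volume
  have hcube : (fun θ : Fin k → ℝ => -θ) ⁻¹' cube k = cube k := by
    ext θ
    simp only [cube, Set.mem_preimage, Set.mem_Icc, Pi.le_def, Pi.neg_apply]
    constructor
    · rintro ⟨h1, h2⟩
      exact ⟨fun i => by linarith [h2 i], fun i => by linarith [h1 i]⟩
    · rintro ⟨h1, h2⟩
      exact ⟨fun i => by linarith [h2 i], fun i => by linarith [h1 i]⟩
  have key : ∫ θ in cube k, (f θ : ℂ) *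
        Complex.exp (Complex.I * ((∑ t, (j t : ℝ) * θ t : ℝ) : ℂ))
      = (starRingEnd ℂ) (∫ θ in cube k, (f θ : ℂ) *
        Complex.exp (Complex.I * ((∑ t, (j t : ℝ) * θ t : ℝ) : ℂ))) := by
    rw [← integral_conj]
    have h1 := hmp.setIntegral_preimage_emb (MeasurableEquiv.neg (Fin k → ℝ)).measurableEmbedding
      (fun θ => (f θ : ℂ) * Complex.exp (Complex.I * ((∑ t, (j t : ℝ) * θ t : ℝ) : ℂ))) (cube k)
    rw [hcube] at h1
    rw [← h1]
    apply integral_congr_ae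
    filter_upwards [hf] with θ hθ
    rw [hθ, map_mul, ← Complex.exp_conj, map_mul, Complex.conj_ofReal, Complex.conj_ofReal,
      Complex.conj_I]
    congr 2
    simp
  rw [← Complex.conj_eq_iff_im, fourierCoef, map_mul, ← key]
  congr 1
  have h2 : (starRingEnd ℂ) 2 = 2 := Complex.conj_ofNat 2
  simp [Complex.conj_ofReal, h2]

/-- For an even `f` the matrix `T_n(f)` is real. -/
theorem toeplitz_eq_map_toeplitzReal {k : ℕ} (f : (Fin k → ℝ) → ℝ)
    (hf : ∀ᵐ θ ∂(volume.restrict (cube k)), f (-θ) = f θ) (n : Fin k → ℕ) :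
    toeplitz f n = (toeplitzReal f n).map (fun x : ℝ => (x : ℂ)) := by
  ext a b
  have h := fourierCoef_im f hf (fun t => ((a t : ℕ) : ℤ) - ((b t : ℕ) : ℤ))
  apply Complex.ext <;> simp [toeplitz, toeplitzReal, h]

/-- The univariate function `r_α(θ) = (2 - 2 cos θ)^{α/2}`. -/
def rFun (α θ : ℝ) : ℝ := (2 - 2 * Real.cos θ) ^ (α / 2)

/-- The Fourier coefficient of index `j` of `r_α` (it is real, as `r_α` is even). -/
def rCoef (α : ℝ) (j : ℕ) : ℝ :=
  ((1 / (2 * (Real.pi : ℂ))) *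
    ∫ θ in (-Real.pi)..Real.pi,
      (rFun α θ : ℂ) * Complex.exp (Complex.I * (((j : ℝ) * θ : ℝ) : ℂ))).re

/-- The symmetric Toeplitz matrix `[t_{|i-j|}]` of size `n`. -/
def symToeplitz (n : ℕ) (t : ℕ → ℝ) : Matrix (Fin n) (Fin n) ℝ :=
  Matrix.of fun i j => t (((i : ℕ) : ℤ) - ((j : ℕ) : ℤ)).natAbs

/-- The Hankel matrix of size `n` whose antidiagonals are, in this order,
`t_2, …, t_{n-1}, 0, 0, 0, t_{n-1}, …, t_2`. -/
def hankelPart (n : ℕ) (t : ℕ → ℝ) : Matrix (Fin n) (Fin n) ℝ :=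
  Matrix.of fun i j =>
    if (i : ℕ) + (j : ℕ) + 2 < n then t ((i : ℕ) + (j : ℕ) + 2)
    else if n < (i : ℕ) + (j : ℕ) then t (2 * n - ((i : ℕ) + (j : ℕ)))
    else 0

/-- The `τ` matrix `τ(T) = T - H(T)` of the symmetric Toeplitz matrix `T = [t_{|i-j|}]`. -/
def tau (n : ℕ) (t : ℕ → ℝ) : Matrix (Fin n) (Fin n) ℝ :=
  symToeplitz n t - hankelPart n t

/-- The Kronecker product `I_{n₁ ⋯ n_{i-1}} ⊗ M ⊗ I_{n_{i+1} ⋯ n_k}`. -/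
def atLevel {k : ℕ} (n : Fin k → ℕ) (i : Fin k) (M : Matrix (Fin (n i)) (Fin (n i)) ℝ) :
    Matrix (MultiIdx n) (MultiIdx n) ℝ :=
  Matrix.of fun a b => if ∀ j, j ≠ i → a j = b j then M (a i) (b i) else 0

/-- `R_n = ∑ᵢ I ⊗ lᵢ T_{nᵢ}(r_{αᵢ}) ⊗ I`. -/
def matR {k : ℕ} (α l : Fin k → ℝ) (n : Fin k → ℕ) : Matrix (MultiIdx n) (MultiIdx n) ℝ :=
  ∑ i, atLevel n i (l i • symToeplitz (n i) (rCoef (α i)))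

/-- The `k`-level `τ` preconditioner `τ(R_n) = ∑ᵢ I ⊗ lᵢ τ(T_{nᵢ}(r_{αᵢ})) ⊗ I`, obtained from
`R_n` by passing to the `τ` matrix of the Toeplitz factor at each level. -/
def tauR {k : ℕ} (α l : Fin k → ℝ) (n : Fin k → ℕ) : Matrix (MultiIdx n) (MultiIdx n) ℝ :=
  ∑ i, atLevel n i (l i • tau (n i) (rCoef (α i)))

/-- The function `q_α(θ) = ∑ᵢ lᵢ |θᵢ|^{αᵢ}`. -/
def qFun {k : ℕ} (α l : Fin k → ℝ) (θ : Fin k → ℝ) : ℝ :=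
  ∑ i, l i * |θ i| ^ (α i)

/-- The spectral condition number `λ_max(A) / λ_min(A)` of a square matrix `A` with real positive
eigenvalues. -/
def specCond {ι : Type*} [Fintype ι] [DecidableEq ι] (A : Matrix ι ι ℝ) : ℝ :=
  sSup (spectrum ℝ A) / sInf (spectrum ℝ A)

/-- The current iterate `x`, residual `r`, and search direction `d` of the preconditioned
conjugate gradient method. -/
structure PCGState (ι : Type*) where
  x : ι → ℝ
  r : ι → ℝ
  d : ι → ℝ

/-- The initial state: `r₀ = b - A x₀`, `d₀ = P⁻¹ r₀`. -/
def pcgInit {ι : Type*} [Fintype ι] [DecidableEq ι] (A P : Matrix ι ι ℝ) (b x₀ : ι → ℝ) :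
    PCGState ι where
  x := x₀
  r := b - A.mulVec x₀
  d := P⁻¹.mulVec (b - A.mulVec x₀)

/-- One step of the preconditioned conjugate gradient method. Once the residual is zero, both
quotients are `0 / _ = 0` and `_ / 0 = 0`, and the iterate no longer changes. -/
def pcgStep {ι : Type*} [Fintype ι] [DecidableEq ι] (A P : Matrix ι ι ℝ) (s : PCGState ι) :
    PCGState ι :=
  let z : ι → ℝ := P⁻¹.mulVec s.r
  let a : ℝ := dotProduct s.r z / dotProduct s.d (A.mulVec s.d)
  let r' : ι → ℝ := s.r - a • A.mulVec s.d
  let z' : ι → ℝ := P⁻¹.mulVec r'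
  let β : ℝ := dotProduct r' z' / dotProduct s.r z
  { x := s.x + a • s.d
    r := r'
    d := z' + β • s.d }

/-- The `m`-th iterate of the preconditioned conjugate gradient method for `A u = b` with the
preconditioner `P` and the initial guess `x₀`. -/
def pcgIterate {ι : Type*} [Fintype ι] [DecidableEq ι] (A P : Matrix ι ι ℝ) (b x₀ : ι → ℝ)
    (m : ℕ) : ι → ℝ :=
  ((pcgStep A P)^[m] (pcgInit A P b x₀)).x

/-- The energy norm `(vᵀ A v)^{1/2}`. -/
def energyNorm {ι : Type*} [Fintype ι] (A : Matrix ι ι ℝ) (v : ι → ℝ) : ℝ :=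
  Real.sqrt (dotProduct v (A.mulVec v))

end

end TauPCG

namespace TauPCG

open Matrix

/-! ### Pencils `A - μ P` with two-sided bounds on the forms -/

section Spectrum

variable {ι : Type*} [Fintype ι]

/-! Everything follows from one size-independent estimate between quadratic forms, `(c₀/2) τ(R) ≤ B
≤ (3π²c₁/8) τ(R)` (`tauR_le_toeplitzReal_le`), which combines a comparison of symbols with a
comparison of matrices.

Symbols: `r_α ≤ |θ|^α ≤ (π²/4) r_α` on `[-π, π]`, so `p` lies between `c₀` and `(π²/4) c₁` times `∑
lᵢ r_{αᵢ}(θᵢ)`. That function generates `R`, and nonnegative symbols give positive semidefinite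
Toeplitz matrices; hence `c₀ R ≤ B ≤ (π²/4) c₁ R`.

Matrices: at each level `T = τ(T) + H(T)`, so `τ/2 ≤ T ≤ 3τ/2` says that `τ ± 2H` is positive
semidefinite. In fact `τ + cH` is strictly diagonally dominant for `|c| ≤ 2`
(`IsDominantSymbol.posDef_tau_add`). This rests on the signs and monotonicity of the Fourier
coefficients of `r_α`, and on a closed form for their partial sums, all consequences of the two-term
recurrence `rCoef_succ`.

The form bounds confine the spectrum of `τ(R)⁻¹B`. They also make each PCG step contract the squared
energy error by a fixed factor, because a step does at least as well as preconditioned steepest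
descent; no Chebyshev estimate is needed. -/

theorem dotProduct_mulVec_comm_of_isHermitian {A : Matrix ι ι ℝ} (hA : A.IsHermitian)
    (x y : ι → ℝ) : x ⬝ᵥ (A *ᵥ y) = y ⬝ᵥ (A *ᵥ x) := by
  have hT : Aᵀ = A := by simpa [IsHermitian, conjTranspose_eq_transpose_of_trivial] using hA
  rw [dotProduct_mulVec, ← mulVec_transpose, hT, dotProduct_comm]

theorem dotProduct_mulVec_pos {A : Matrix ι ι ℝ} (hA : A.PosDef) {x : ι → ℝ} (hx : x ≠ 0) :
    0 < x ⬝ᵥ (A *ᵥ x) := by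
  simpa using hA.dotProduct_mulVec_pos hx

theorem dotProduct_mulVec_nonneg {A : Matrix ι ι ℝ} (hA : A.PosSemidef) (x : ι → ℝ) :
    0 ≤ x ⬝ᵥ (A *ᵥ x) := by
  simpa using hA.dotProduct_mulVec_nonneg x

variable [DecidableEq ι]

/-- A complex eigenvalue of the pencil `A - μ P` is real and lies between any two constants
bounding the form of `A` by that of `P`. -/
theorem spectrum_inv_mul {A P : Matrix ι ι ℝ} (hA : A.IsHermitian) (hP : P.PosDef) {a b : ℝ}
    (ha : ∀ x, a * (x ⬝ᵥ (P *ᵥ x)) ≤ x ⬝ᵥ (A *ᵥ x))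
    (hb : ∀ x, x ⬝ᵥ (A *ᵥ x) ≤ b * (x ⬝ᵥ (P *ᵥ x)))
    {μ : ℂ} (hμ : μ ∈ spectrum ℂ ((P⁻¹ * A).map (fun x : ℝ => (x : ℂ)))) :
    (a ≤ μ.re ∧ μ.re ≤ b) ∧ μ.im = 0 := by
  have hPu : IsUnit P.det := (isUnit_iff_isUnit_det _).1 hP.isUnit
  rw [← spectrum_toLin', ← Module.End.hasEigenvalue_iff_mem_spectrum] at hμ
  obtain ⟨v, hv⟩ := hμ.exists_hasEigenvector
  have hv1 : (P⁻¹ * A).map (fun x : ℝ => (x : ℂ)) *ᵥ v = μ • v := by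
    simpa using hv.apply_eq_smul
  set x : ι → ℝ := fun i => (v i).re with hx
  set y : ι → ℝ := fun i => (v i).im with hy
  have hre : (P⁻¹ * A) *ᵥ x = μ.re • x - μ.im • y := by
    ext i
    have := congrArg Complex.re (congrFun hv1 i)
    simpa [mulVec, dotProduct, hx, hy] using this
  have him : (P⁻¹ * A) *ᵥ y = μ.re • y + μ.im • x := by
    ext i
    have := congrArg Complex.im (congrFun hv1 i)
    simpa [mulVec, dotProduct, hx, hy] using this
  have hmul : ∀ z w, (P⁻¹ * A) *ᵥ z = w → A *ᵥ z = P *ᵥ w := by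
    intro z w h
    rw [← h, mulVec_mulVec, mul_nonsing_inv_cancel_left _ _ hPu]
  have hAx := hmul _ _ hre
  have hAy := hmul _ _ him
  rw [mulVec_sub, mulVec_smul, mulVec_smul] at hAx
  rw [mulVec_add, mulVec_smul, mulVec_smul] at hAy
  have hxy : x ≠ 0 ∨ y ≠ 0 := by
    by_contra! h
    apply hv.2
    ext i
    exact Complex.ext (congrFun h.1 i) (congrFun h.2 i)
  have nx := dotProduct_mulVec_nonneg hP.posSemidef x
  have ny := dotProduct_mulVec_nonneg hP.posSemidef y
  have hpos : 0 < x ⬝ᵥ (P *ᵥ x) + y ⬝ᵥ (P *ᵥ y) := by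
    rcases hxy with h | h
    · linarith [dotProduct_mulVec_pos hP h]
    · linarith [dotProduct_mulVec_pos hP h]
  have e1 := congrArg (fun z => y ⬝ᵥ z) hAx
  have e2 := congrArg (fun z => x ⬝ᵥ z) hAy
  have e3 := congrArg (fun z => x ⬝ᵥ z) hAx
  have e4 := congrArg (fun z => y ⬝ᵥ z) hAy
  simp only [dotProduct_sub, dotProduct_add, dotProduct_smul, smul_eq_mul] at e1 e2 e3 e4
  have c1 := dotProduct_mulVec_comm_of_isHermitian hA x y
  have c2 := dotProduct_mulVec_comm_of_isHermitian hP.isHermitian x y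
  -- By symmetry of `A` and `P`, the two mixed pairings of the real and imaginary parts of the
  -- eigenvector differ exactly by `μ.im` times the positive number `hpos`.
  have him0 : μ.im = 0 := by
    have : μ.im * (x ⬝ᵥ (P *ᵥ x) + y ⬝ᵥ (P *ᵥ y)) = 0 := by
      rw [c1, c2] at e2; linarith
    exact (mul_eq_zero.1 this).resolve_right hpos.ne'
  rw [him0] at e3 e4
  refine ⟨⟨?_, ?_⟩, him0⟩
  · refine le_of_mul_le_mul_right ?_ hpos
    linarith [ha x, ha y]
  · refine le_of_mul_le_mul_right ?_ hpos
    linarith [hb x, hb y]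

theorem specCond_inv_mul_le {A P : Matrix ι ι ℝ} (hA : A.IsHermitian) (hP : P.PosDef) {a b : ℝ}
    (ha₀ : 0 < a) (hb₀ : 0 ≤ b)
    (ha : ∀ x, a * (x ⬝ᵥ (P *ᵥ x)) ≤ x ⬝ᵥ (A *ᵥ x))
    (hb : ∀ x, x ⬝ᵥ (A *ᵥ x) ≤ b * (x ⬝ᵥ (P *ᵥ x))) :
    specCond (P⁻¹ * A) ≤ b / a := by
  have key : ∀ μ ∈ spectrum ℝ (P⁻¹ * A), a ≤ μ ∧ μ ≤ b := by
    intro μ hμ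
    have h : (μ : ℂ) ∈ spectrum ℂ ((P⁻¹ * A).map (fun x : ℝ => (x : ℂ))) := by
      -- Failure of invertibility is the vanishing of a determinant, which is preserved by the
      -- embedding of `ℝ` into `ℂ`.
      rw [spectrum.mem_iff, isUnit_iff_isUnit_det, isUnit_iff_ne_zero, not_not] at hμ ⊢
      have := congrArg Complex.ofRealHom hμ
      rw [RingHom.map_det, map_zero] at this
      rw [← this]
      congr 1
      ext i j
      by_cases hij : i = j <;> simp [algebraMap_matrix_apply, hij]
    simpa using (spectrum_inv_mul hA hP ha hb h).1
  unfold specCond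
  rcases (spectrum ℝ (P⁻¹ * A)).eq_empty_or_nonempty with h | h
  · rw [h]; simp; positivity
  · have h1 : sSup (spectrum ℝ (P⁻¹ * A)) ≤ b := csSup_le h fun μ hμ => (key μ hμ).2
    have h2 : a ≤ sInf (spectrum ℝ (P⁻¹ * A)) := le_csInf h fun μ hμ => (key μ hμ).1
    gcongr

end Spectrum

/-! ### Energy contraction of preconditioned conjugate gradients -/

section PCG

variable {ι : Type*} [Fintype ι] [DecidableEq ι]

/-- The relations between the iterate, the residual and the search direction that the
preconditioned conjugate gradient method preserves; `u` is the exact solution. -/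
structure PCGInvariant (A P : Matrix ι ι ℝ) (u : ι → ℝ) (s : PCGState ι) : Prop where
  residual : s.r = A *ᵥ (u - s.x)
  orthogonal : s.r ⬝ᵥ (s.d - P⁻¹ *ᵥ s.r) = 0
  conjugate : (s.d - P⁻¹ *ᵥ s.r) ⬝ᵥ (A *ᵥ s.d) = 0

theorem PCGInvariant.init (A P : Matrix ι ι ℝ) (u x₀ : ι → ℝ) :
    PCGInvariant A P u (pcgInit A P (A *ᵥ u) x₀) where
  residual := by simp [pcgInit, mulVec_sub]
  orthogonal := by simp [pcgInit]
  conjugate := by simp [pcgInit]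

/-- As long as the residual does not vanish, one step lowers the energy of the error by the
factor `1 - a / b`. -/
theorem PCGInvariant.step {A P : Matrix ι ι ℝ} (hA : A.PosDef) (hP : P.PosDef)
    {u : ι → ℝ} {s : PCGState ι} (hs : PCGInvariant A P u s) {a b : ℝ} (ha₀ : 0 < a) (hb₀ : 0 < b)
    (ha : ∀ x, a * (x ⬝ᵥ (P *ᵥ x)) ≤ x ⬝ᵥ (A *ᵥ x))
    (hb : ∀ x, x ⬝ᵥ (A *ᵥ x) ≤ b * (x ⬝ᵥ (P *ᵥ x))) :
    PCGInvariant A P u (pcgStep A P s) ∧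
      ((pcgStep A P s).x - u) ⬝ᵥ (A *ᵥ ((pcgStep A P s).x - u)) ≤
        (1 - a / b) * ((s.x - u) ⬝ᵥ (A *ᵥ (s.x - u))) := by
  have hPu : IsUnit P.det := (isUnit_iff_isUnit_det _).1 hP.isUnit
  obtain ⟨x, r, d⟩ := s
  obtain ⟨hr, ho, hc⟩ := hs
  simp only at hr ho hc
  -- A zero residual means the iterate is exact, as `A` is definite. Both quotients of the step are
  -- then zero, so the invariant persists.
  by_cases hr0 : r = 0
  · have hux : u - x = 0 := by
      by_contra h
      have := dotProduct_mulVec_pos hA h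
      rw [← hr, hr0, dotProduct_zero] at this
      exact this.false
    have hx : x - u = 0 := by rw [← neg_sub, hux, neg_zero]
    subst hr0
    refine ⟨⟨?_, ?_, ?_⟩, ?_⟩ <;> simp [pcgStep, hux, hx]
  set z := P⁻¹ *ᵥ r with hz
  have hPz : P *ᵥ z = r := by rw [hz, mulVec_mulVec, mul_nonsing_inv _ hPu, one_mulVec]
  have hz0 : z ≠ 0 := by
    intro h
    rw [h, mulVec_zero] at hPz
    exact hr0 hPz.symm
  have hrz : 0 < r ⬝ᵥ z := by
    have := dotProduct_mulVec_pos hP hz0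
    rwa [hPz, dotProduct_comm] at this
  set w := d - z with hw
  have hdw : d = z + w := by rw [hw]; abel
  have hrd : r ⬝ᵥ d = r ⬝ᵥ z := by rw [hdw, dotProduct_add, ho, add_zero]
  have hd0 : d ≠ 0 := by
    intro h
    rw [h, dotProduct_zero] at hrd
    exact hrz.ne hrd
  have hdd : 0 < d ⬝ᵥ (A *ᵥ d) := dotProduct_mulVec_pos hA hd0
  have hcomm := dotProduct_mulVec_comm_of_isHermitian hA.isHermitian
  have hzd : z ⬝ᵥ (A *ᵥ d) = d ⬝ᵥ (A *ᵥ d) := by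
    conv_rhs => rw [hdw]
    rw [add_dotProduct, ← hdw, hc, add_zero]
  -- Pythagoras in the `A` inner product: `z = d - w` with `w` conjugate to `d`. This is what makes
  -- the step at least as good as one along `z`.
  have hzz : d ⬝ᵥ (A *ᵥ d) ≤ z ⬝ᵥ (A *ᵥ z) := by
    have h1 : z ⬝ᵥ (A *ᵥ d) = z ⬝ᵥ (A *ᵥ z) + z ⬝ᵥ (A *ᵥ w) := by
      rw [hdw, mulVec_add, dotProduct_add]
    have h2 : w ⬝ᵥ (A *ᵥ d) = w ⬝ᵥ (A *ᵥ z) + w ⬝ᵥ (A *ᵥ w) := by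
      rw [hdw, mulVec_add, dotProduct_add]
    have h3 := dotProduct_mulVec_nonneg hA.posSemidef w
    have h4 := hcomm z w
    linarith
  set t := r ⬝ᵥ z / d ⬝ᵥ (A *ᵥ d) with ht
  have htd : t * (d ⬝ᵥ (A *ᵥ d)) = r ⬝ᵥ z := div_mul_cancel₀ _ hdd.ne'
  have htpos : 0 < t := div_pos hrz hdd
  set r' := r - t • A *ᵥ d with hr'
  set z' := P⁻¹ *ᵥ r' with hz'
  set β := r' ⬝ᵥ z' / r ⬝ᵥ z with hβ
  have hstep : pcgStep A P ⟨x, r, d⟩ = ⟨x + t • d, r', z' + β • d⟩ := rfl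
  rw [hstep]
  have hr'd : r' ⬝ᵥ d = 0 := by
    rw [hr', sub_dotProduct, smul_dotProduct, dotProduct_comm (A *ᵥ d), smul_eq_mul, htd, hrd,
      sub_self]
  have hr'w : r' ⬝ᵥ w = 0 := by
    rw [hr', sub_dotProduct, smul_dotProduct, dotProduct_comm (A *ᵥ d), hc, ho]; simp
  have hr'z : r' ⬝ᵥ z = 0 := by
    have : r' ⬝ᵥ d = r' ⬝ᵥ z + r' ⬝ᵥ w := by rw [hdw, dotProduct_add]
    linarith
  -- Consecutive residuals are orthogonal for `P⁻¹`; together with the choice of `β` this makes the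
  -- next direction conjugate to `d`.
  have hz'r : z' ⬝ᵥ r = 0 := by
    rw [← hPz, dotProduct_mulVec_comm_of_isHermitian hP.isHermitian, hz', mulVec_mulVec,
      mul_nonsing_inv _ hPu, one_mulVec, dotProduct_comm, hr'z]
  have hww : z' + β • d - z' = β • d := by abel
  refine ⟨⟨?_, ?_, ?_⟩, ?_⟩
  · change r' = A *ᵥ (u - (x + t • d))
    rw [hr', hr, ← sub_sub, mulVec_sub A (u - x), mulVec_smul]
  · change r' ⬝ᵥ (z' + β • d - z') = 0
    rw [hww, dotProduct_smul, hr'd, smul_zero]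
  · change (z' + β • d - z') ⬝ᵥ (A *ᵥ (z' + β • d)) = 0
    rw [hww, smul_dotProduct, mulVec_add, mulVec_smul, dotProduct_add, dotProduct_smul,
      hcomm d z']
    have h1 : z' ⬝ᵥ r' = -(t * (z' ⬝ᵥ (A *ᵥ d))) := by
      rw [hr', dotProduct_sub, hz'r, dotProduct_smul, smul_eq_mul, zero_sub]
    have h2 : β * (r ⬝ᵥ z) = r' ⬝ᵥ z' := div_mul_cancel₀ _ hrz.ne'
    have h3 : t * (z' ⬝ᵥ (A *ᵥ d) + β * (d ⬝ᵥ (A *ᵥ d))) = 0 := by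
      rw [dotProduct_comm r'] at h2
      rw [← htd] at h2
      linarith
    rw [smul_eq_mul, smul_eq_mul, (mul_eq_zero.1 h3).resolve_left htpos.ne', mul_zero]
  · change (x + t • d - u) ⬝ᵥ (A *ᵥ (x + t • d - u)) ≤ _
    set e := x - u with he
    have hAe : A *ᵥ e = -r := by rw [hr, ← mulVec_neg, neg_sub]
    have hxe : x + t • d - u = e + t • d := by rw [he]; abel
    rw [hxe]
    have h1 : (e + t • d) ⬝ᵥ (A *ᵥ (e + t • d)) =
        e ⬝ᵥ (A *ᵥ e) - t * (r ⬝ᵥ z) := by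
      rw [mulVec_add, mulVec_smul, dotProduct_add, add_dotProduct, add_dotProduct, dotProduct_smul,
        dotProduct_smul, smul_dotProduct, smul_dotProduct, hcomm e d, hAe, dotProduct_neg d,
        dotProduct_comm d r, hrd]
      simp only [smul_eq_mul]
      rw [htd]
      ring
    have h2 : z ⬝ᵥ (A *ᵥ z) ≤ b * (r ⬝ᵥ z) := by
      have := hb z
      rwa [hPz, dotProduct_comm z r] at this
    -- The step length is at least `1 / b`, since `d ⬝ᵥ A d ≤ z ⬝ᵥ A z ≤ b (r ⬝ᵥ z) = b t (d ⬝ᵥ A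
    -- d)`.
    have h3 : 1 ≤ b * t := by
      have : d ⬝ᵥ (A *ᵥ d) * 1 ≤ d ⬝ᵥ (A *ᵥ d) * (b * t) := by
        have := htd; nlinarith
      exact le_of_mul_le_mul_left this hdd
    -- Expand the `P`-form of `a • e + z`, which is nonnegative: `a² (e ⬝ᵥ P e) - 2a (e ⬝ᵥ A e) + r
    -- ⬝ᵥ z ≥ 0`, and bound the first term by `a (e ⬝ᵥ A e)`.
    have h4 : a * (e ⬝ᵥ (A *ᵥ e)) ≤ r ⬝ᵥ z := by
      have e1 := dotProduct_mulVec_nonneg hP.posSemidef (a • e + z)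
      have e2 := ha e
      have e3 : z ⬝ᵥ (P *ᵥ e) = e ⬝ᵥ r := by
        rw [dotProduct_mulVec_comm_of_isHermitian hP.isHermitian, hPz]
      have e4 : e ⬝ᵥ r = -(e ⬝ᵥ (A *ᵥ e)) := by rw [hAe]; simp
      rw [mulVec_add, mulVec_smul, hPz] at e1
      simp only [add_dotProduct, dotProduct_add, smul_dotProduct, dotProduct_smul, smul_eq_mul,
        e3, dotProduct_comm z r] at e1
      rw [e4] at e1
      nlinarith
    rw [h1]
    have h5 : a / b * (e ⬝ᵥ (A *ᵥ e)) ≤ t * (r ⬝ᵥ z) := by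
      rw [div_mul_eq_mul_div, div_le_iff₀ hb₀]
      nlinarith
    linarith

theorem pcgIterate_energy_le {A P : Matrix ι ι ℝ} (hA : A.PosDef) (hP : P.PosDef) {a b : ℝ}
    (ha₀ : 0 < a) (hab : a ≤ b)
    (ha : ∀ x, a * (x ⬝ᵥ (P *ᵥ x)) ≤ x ⬝ᵥ (A *ᵥ x))
    (hb : ∀ x, x ⬝ᵥ (A *ᵥ x) ≤ b * (x ⬝ᵥ (P *ᵥ x))) (u x₀ : ι → ℝ) (m : ℕ) :
    (pcgIterate A P (A *ᵥ u) x₀ m - u) ⬝ᵥ (A *ᵥ (pcgIterate A P (A *ᵥ u) x₀ m - u)) ≤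
      (1 - a / b) ^ m * ((x₀ - u) ⬝ᵥ (A *ᵥ (x₀ - u))) := by
  have hb₀ : 0 < b := ha₀.trans_le hab
  have hq : 0 ≤ 1 - a / b := sub_nonneg.2 ((div_le_one hb₀).2 hab)
  suffices h : PCGInvariant A P u ((pcgStep A P)^[m] (pcgInit A P (A *ᵥ u) x₀)) ∧
      (((pcgStep A P)^[m] (pcgInit A P (A *ᵥ u) x₀)).x - u) ⬝ᵥ
        (A *ᵥ (((pcgStep A P)^[m] (pcgInit A P (A *ᵥ u) x₀)).x - u)) ≤
      (1 - a / b) ^ m * ((x₀ - u) ⬝ᵥ (A *ᵥ (x₀ - u))) from h.2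
  induction m with
  | zero => exact ⟨PCGInvariant.init A P u x₀, by simp [pcgInit]⟩
  | succ m ih =>
    rw [Function.iterate_succ_apply']
    obtain ⟨h1, h2⟩ := ih.1.step hA hP ha₀ hb₀ ha hb
    refine ⟨h1, h2.trans ?_⟩
    rw [pow_succ', mul_assoc]
    exact mul_le_mul_of_nonneg_left ih.2 hq

/-- The contraction factor involves only `a` and `b`, so `M` can be chosen before the index type and
the matrices. -/
theorem exists_forall_energyNorm_pcgIterate_le {a b : ℝ} (ha₀ : 0 < a) (hab : a ≤ b) {ε : ℝ}
    (hε : 0 < ε) :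
    ∃ M : ℕ, ∀ {κ : Type} [Fintype κ] [DecidableEq κ] {A P : Matrix κ κ ℝ}, A.PosDef → P.PosDef →
      (∀ x, a * (x ⬝ᵥ (P *ᵥ x)) ≤ x ⬝ᵥ (A *ᵥ x)) →
      (∀ x, x ⬝ᵥ (A *ᵥ x) ≤ b * (x ⬝ᵥ (P *ᵥ x))) →
      ∀ (u x₀ : κ → ℝ) (m : ℕ), M ≤ m →
        energyNorm A (pcgIterate A P (A *ᵥ u) x₀ m - u) ≤ ε * energyNorm A (x₀ - u) := by
  have hb₀ : 0 < b := ha₀.trans_le hab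
  have hq : 0 ≤ 1 - a / b := sub_nonneg.2 ((div_le_one hb₀).2 hab)
  have hq1 : 1 - a / b < 1 := by linarith [div_pos ha₀ hb₀]
  -- The target is `ε ^ 2` because the contraction concerns the square of the energy norm.
  obtain ⟨M, hM⟩ := exists_pow_lt_of_lt_one (sq_pos_of_pos hε) hq1
  refine ⟨M, fun {κ} _ _ {A P} hA hP ha hb u x₀ m hm => ?_⟩
  have h0 := dotProduct_mulVec_nonneg hA.posSemidef (x₀ - u)
  unfold energyNorm
  rw [Real.sqrt_le_left (by positivity), mul_pow, Real.sq_sqrt h0]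
  refine (pcgIterate_energy_le hA hP ha₀ hab ha hb u x₀ m).trans ?_
  exact mul_le_mul_of_nonneg_right ((pow_le_pow_of_le_one hq hq1.le hm).trans hM.le) h0

end PCG

end TauPCG

namespace TauPCG

open Matrix

/-! ### Diagonal dominance of `τ(T) + c H(T)` -/

section DiagonallyDominant

/-- Gershgorin: each eigenvalue is within an off-diagonal row sum of the corresponding diagonal
entry. -/
theorem posDef_of_sum_row_lt_diag {ι : Type*} [Fintype ι] [DecidableEq ι] {M : Matrix ι ι ℝ}
    (hM : M.IsHermitian) (h : ∀ i, ∑ j ∈ Finset.univ.erase i, |M i j| < M i i) : M.PosDef := by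
  rw [hM.posDef_iff_eigenvalues_pos]
  intro i
  have hmem := hM.eigenvalues_mem_spectrum_real i
  rw [← spectrum_toLin', ← Module.End.hasEigenvalue_iff_mem_spectrum] at hmem
  obtain ⟨k, hk⟩ := eigenvalue_mem_ball hmem
  rw [Metric.mem_closedBall, Real.dist_eq] at hk
  simp only [Real.norm_eq_abs] at hk
  have := neg_abs_le (hM.eigenvalues i - M k k)
  linarith [h k]

/-- The properties of a sequence `t` that make `τ(T) + c H(T)` strictly diagonally dominant
for the symmetric Toeplitz matrix `T = [t_{|i-j|}]` and `|c| ≤ 2`. -/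
structure IsDominantSymbol (t : ℕ → ℝ) : Prop where
  nonpos : ∀ k, 1 ≤ k → t k ≤ 0
  mono : ∀ j k, 1 ≤ j → j ≤ k → t j ≤ t k
  sum_pos : ∀ n, 1 ≤ n → 0 < ∑ k ∈ Finset.range n, t k + ∑ k ∈ Finset.Ico 1 n, t k

theorem sum_le_sum_comp_of_nonpos {ι κ : Type*} [DecidableEq κ] {s : Finset ι} {s' : Finset κ}
    {φ : ι → κ} {f : κ → ℝ} (hφ : Set.InjOn φ s) (hm : ∀ i ∈ s, φ i ∈ s')
    (hf : ∀ j ∈ s', f j ≤ 0) : ∑ j ∈ s', f j ≤ ∑ i ∈ s, f (φ i) := by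
  rw [← Finset.sum_image hφ]
  have hsub : s.image φ ⊆ s' := Finset.image_subset_iff.2 hm
  rw [← Finset.sum_sdiff hsub]
  have : ∑ j ∈ s' \ s.image φ, f j ≤ 0 :=
    Finset.sum_nonpos fun j hj => hf j (Finset.sdiff_subset hj)
  linarith

variable {n : ℕ} {t : ℕ → ℝ}

/-- Row `i` of `T` and `H` together runs through `t_0, …, t_{n-1}` and `t_1, …, t_{n-1}`, omitting
at most `t_{i+1}` and `t_{n-i}`. Omitted terms are nonpositive, so the row sum is at least the
quantity in `sum_pos`. -/
theorem IsDominantSymbol.sum_row_pos (ht : IsDominantSymbol t) (i : Fin n) :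
    0 < ∑ j, (symToeplitz n t i j + hankelPart n t i j) := by
  obtain ⟨i, hi⟩ := i
  have hsplit : ∑ j, (symToeplitz n t ⟨i, hi⟩ j + hankelPart n t ⟨i, hi⟩ j) =
      ∑ j ∈ Finset.range n, ((if j ≤ i then t (i - j) else 0) + (if i < j then t (j - i) else 0) +
        (if i + j + 2 < n then t (i + j + 2) else 0) +
        (if n < i + j then t (2 * n - (i + j)) else 0)) := by
    rw [← Fin.sum_univ_eq_sum_range]
    refine Finset.sum_congr rfl fun j _ => ?_
    simp only [symToeplitz, hankelPart, of_apply]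
    rw [add_assoc ((if (j : ℕ) ≤ i then t (i - j) else 0) + _)]
    congr 1
    · rcases le_or_gt (j : ℕ) i with h | h
      · rw [if_pos h, if_neg h.not_gt, add_zero]; congr 1; omega
      · rw [if_neg h.not_ge, if_pos h, zero_add]; congr 1; omega
    · rcases lt_or_ge (i + (j : ℕ) + 2) n with h | h
      · rw [if_pos h, if_pos h, if_neg (by omega), add_zero]
      · rw [if_neg h.not_gt, if_neg h.not_gt, zero_add]
  rw [hsplit, Finset.sum_add_distrib, Finset.sum_add_distrib, Finset.sum_add_distrib]
  simp only [← Finset.sum_filter]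
  have e1 : ∑ j ∈ Finset.range n with j ≤ i, t (i - j) = ∑ k ∈ Finset.range (i + 1), t k := by
    refine Finset.sum_nbij' (fun j => i - j) (fun j => i - j) ?_ ?_ ?_ ?_ ?_ <;>
      intros <;> simp only [Finset.mem_filter, Finset.mem_range] at * <;> omega
  have e2 : ∑ k ∈ Finset.Ico 1 (n - i), t k ≤ ∑ j ∈ Finset.range n with i < j, t (j - i) := by
    refine sum_le_sum_comp_of_nonpos (φ := fun j => j - i) ?_ ?_ ?_
    · intro a ha b hb hab
      simp only [Finset.coe_filter, Finset.mem_range, Set.mem_ofPred_eq] at ha hb hab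
      omega
    · intro a ha
      simp only [Finset.mem_filter, Finset.mem_range, Finset.mem_Ico] at ha ⊢
      omega
    · exact fun j hj => ht.nonpos j (Finset.mem_Ico.1 hj).1
  have e3 : ∑ k ∈ Finset.Ico (i + 1) n, t k ≤
      ∑ j ∈ Finset.range n with i + j + 2 < n, t (i + j + 2) := by
    refine sum_le_sum_comp_of_nonpos (φ := fun j => i + j + 2) ?_ ?_ ?_
    · intro a ha b hb hab
      simp only at hab
      omega
    · intro a ha
      simp only [Finset.mem_filter, Finset.mem_range, Finset.mem_Ico] at ha ⊢
      omega
    · exact fun j hj => ht.nonpos j (le_trans (by omega) (Finset.mem_Ico.1 hj).1)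
  have e4 : ∑ k ∈ Finset.Ico (n - i) n, t k ≤
      ∑ j ∈ Finset.range n with n < i + j, t (2 * n - (i + j)) := by
    refine sum_le_sum_comp_of_nonpos (φ := fun j => 2 * n - (i + j)) ?_ ?_ ?_
    · intro a ha b hb hab
      simp only [Finset.coe_filter, Finset.mem_range, Set.mem_ofPred_eq] at ha hb hab
      omega
    · intro a ha
      simp only [Finset.mem_filter, Finset.mem_range, Finset.mem_Ico] at ha ⊢
      omega
    · exact fun j hj => ht.nonpos j (le_trans (by omega) (Finset.mem_Ico.1 hj).1)
  have s1 : ∑ k ∈ Finset.range (i + 1), t k + ∑ k ∈ Finset.Ico (i + 1) n, t k =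
      ∑ k ∈ Finset.range n, t k := Finset.sum_range_add_sum_Ico _ (by omega)
  have s2 : ∑ k ∈ Finset.Ico 1 (n - i), t k + ∑ k ∈ Finset.Ico (n - i) n, t k =
      ∑ k ∈ Finset.Ico 1 n, t k := Finset.sum_Ico_consecutive _ (by omega) (by omega)
  have := ht.sum_pos n (by omega)
  linarith

theorem IsDominantSymbol.hankelPart_nonpos (ht : IsDominantSymbol t) (i j : Fin n) :
    hankelPart n t i j ≤ 0 := by
  simp only [hankelPart, of_apply]
  split_ifs
  · exact ht.nonpos _ (by omega)
  · exact ht.nonpos _ (by omega)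
  · exact le_rfl

theorem IsDominantSymbol.symToeplitz_le_hankelPart (ht : IsDominantSymbol t) {i j : Fin n}
    (hij : i ≠ j) : symToeplitz n t i j ≤ hankelPart n t i j := by
  have hij' : (i : ℕ) ≠ j := fun h => hij (Fin.ext h)
  simp only [hankelPart, symToeplitz, of_apply]
  split_ifs
  · exact ht.mono _ _ (by omega) (by omega)
  · exact ht.mono _ _ (by omega) (by omega)
  · exact ht.nonpos _ (by omega)

theorem isHermitian_symToeplitz (n : ℕ) (t : ℕ → ℝ) : (symToeplitz n t).IsHermitian := by
  ext i j
  simp only [symToeplitz, conjTranspose_apply, of_apply, star_trivial]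
  congr 1
  omega

theorem isHermitian_hankelPart (n : ℕ) (t : ℕ → ℝ) : (hankelPart n t).IsHermitian := by
  ext i j
  simp only [hankelPart, conjTranspose_apply, of_apply, star_trivial, add_comm (j : ℕ) (i : ℕ)]

/-- Off the diagonal `T ≤ H ≤ 0`, so `|T - H + cH| ≤ (H - T) - 2H = -(T + H)`; on the diagonal the
entry is at least `T + H`. Dominance thus reduces to positive row sums of `T + H`. -/
theorem IsDominantSymbol.posDef_tau_add (ht : IsDominantSymbol t) {c : ℝ} (hc : |c| ≤ 2) :
    (tau n t + c • hankelPart n t).PosDef := by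
  have hH : (c • hankelPart n t).IsHermitian := by
    have := isHermitian_hankelPart n t
    rw [IsHermitian] at this ⊢
    rw [conjTranspose_smul, this, star_trivial]
  refine posDef_of_sum_row_lt_diag
    (((isHermitian_symToeplitz n t).sub (isHermitian_hankelPart n t)).add hH) fun i => ?_
  have hbound : ∀ j, |c * hankelPart n t i j| ≤ -2 * hankelPart n t i j := by
    intro j
    have h0 := ht.hankelPart_nonpos i j
    rw [abs_mul, abs_of_nonpos h0]
    nlinarith
  have hoff : ∑ j ∈ Finset.univ.erase i, |(tau n t + c • hankelPart n t) i j| ≤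
      ∑ j ∈ Finset.univ.erase i, -(symToeplitz n t i j + hankelPart n t i j) := by
    refine Finset.sum_le_sum fun j hj => ?_
    have h1 := ht.symToeplitz_le_hankelPart (Finset.ne_of_mem_erase hj).symm
    simp only [tau, Matrix.add_apply, Matrix.sub_apply, Matrix.smul_apply, smul_eq_mul]
    refine (abs_add_le _ _).trans ?_
    rw [abs_of_nonpos (sub_nonpos.2 h1)]
    linarith [hbound j]
  have hrow := ht.sum_row_pos i
  rw [← Finset.add_sum_erase _ _ (Finset.mem_univ i)] at hrow
  rw [Finset.sum_neg_distrib] at hoff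
  have hdiag : symToeplitz n t i i + hankelPart n t i i ≤
      (tau n t + c • hankelPart n t) i i := by
    simp only [tau, Matrix.add_apply, Matrix.sub_apply, Matrix.smul_apply, smul_eq_mul]
    have := neg_abs_le (c * hankelPart n t i i)
    linarith [hbound i]
  linarith

theorem IsDominantSymbol.posDef_tau (ht : IsDominantSymbol t) : (tau n t).PosDef := by
  simpa using ht.posDef_tau_add (n := n) (c := 0) (by simp)

/-- `T - τ/2 = (τ + 2H)/2`; the companion upper bound uses `(τ - 2H)/2`. -/
theorem IsDominantSymbol.posSemidef_symToeplitz_sub (ht : IsDominantSymbol t) :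
    (symToeplitz n t - (1 / 2 : ℝ) • tau n t).PosSemidef := by
  have h := (ht.posDef_tau_add (n := n) (c := 2) (by simp)).posSemidef.smul
    (a := (1 / 2 : ℝ)) (by norm_num)
  convert h using 1
  ext i j
  simp [tau]
  ring

theorem IsDominantSymbol.posSemidef_sub_symToeplitz (ht : IsDominantSymbol t) :
    ((3 / 2 : ℝ) • tau n t - symToeplitz n t).PosSemidef := by
  have h := (ht.posDef_tau_add (n := n) (c := -2) (by simp)).posSemidef.smul
    (a := (1 / 2 : ℝ)) (by norm_num)
  convert h using 1
  ext i j
  simp [tau]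
  ring

end DiagonallyDominant

/-! ### Fourier coefficients and size of `(2 - 2 cos θ)^{α/2}` -/

section FourierCoefficients

theorem two_sub_two_mul_cos_nonneg (θ : ℝ) : 0 ≤ 2 - 2 * Real.cos θ := by
  linarith [Real.cos_le_one θ]

theorem rFun_nonneg (α θ : ℝ) : 0 ≤ rFun α θ := Real.rpow_nonneg (two_sub_two_mul_cos_nonneg θ) _

theorem continuous_rFun {α : ℝ} (hα : 0 ≤ α) : Continuous (rFun α) :=
  Continuous.rpow_const (by fun_prop) fun _ => Or.inr (by positivity)

theorem rCoef_eq {α : ℝ} (hα : 0 ≤ α) (j : ℕ) :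
    rCoef α j = 1 / (2 * Real.pi) * ∫ θ in (-Real.pi)..Real.pi, rFun α θ * Real.cos (j * θ) := by
  have hint : IntervalIntegrable (fun θ : ℝ => (rFun α θ : ℂ) *
      Complex.exp (Complex.I * (((j : ℝ) * θ : ℝ) : ℂ))) volume (-Real.pi) Real.pi := by
    have := continuous_rFun hα
    exact Continuous.intervalIntegrable (by fun_prop) _ _
  have hre : ∀ z : ℂ, ((1 / (2 * (Real.pi : ℂ))) * z).re = 1 / (2 * Real.pi) * z.re := by
    intro z
    rw [show (1 / (2 * (Real.pi : ℂ))) = ((1 / (2 * Real.pi) : ℝ) : ℂ) by push_cast; rfl,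
      Complex.re_ofReal_mul]
  rw [rCoef, hre]
  congr 1
  have h := Complex.reCLM.intervalIntegral_comp_comm hint
  rw [Complex.reCLM_apply] at h
  rw [← h]
  congr 1
  ext θ
  rw [Complex.reCLM_apply, Complex.re_ofReal_mul, mul_comm Complex.I, Complex.exp_ofReal_mul_I_re]

/-- Differentiating `r_α` lowers its exponent by one; the identity `sin θ (sin (k+1)θ - sin kθ) = (1
- cos θ)(cos (k+1)θ + cos kθ)` restores the lost factor. -/
theorem hasDerivAt_rFun_mul {α θ : ℝ} (hθ : Real.cos θ ≠ 1) (k : ℕ) :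
    HasDerivAt (fun θ => rFun α θ * (Real.sin ((k + 1 : ℕ) * θ) - Real.sin (k * θ)))
      ((k + 1 + α / 2) * (rFun α θ * Real.cos ((k + 1 : ℕ) * θ)) -
        (k - α / 2) * (rFun α θ * Real.cos (k * θ))) θ := by
  have hb : 0 < 2 - 2 * Real.cos θ := by
    have := lt_of_le_of_ne (Real.cos_le_one θ) hθ
    linarith
  have h1 : HasDerivAt (rFun α) (2 * Real.sin θ * (α / 2) * (2 - 2 * Real.cos θ) ^ (α / 2 - 1))
      θ := by
    have : HasDerivAt (fun θ => 2 - 2 * Real.cos θ) (2 * Real.sin θ) θ := by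
      have := ((Real.hasDerivAt_cos θ).const_mul 2).const_sub 2
      exact this.congr_deriv (by ring)
    exact this.rpow_const (Or.inl hb.ne')
  have hsin : ∀ m : ℕ, HasDerivAt (fun θ : ℝ => Real.sin (m * θ)) (m * Real.cos (m * θ)) θ := by
    intro m
    have := ((hasDerivAt_id θ).const_mul (m : ℝ)).sin
    simp only [id, mul_one] at this
    rwa [mul_comm]
  have h2 := h1.mul ((hsin (k + 1)).sub (hsin k))
  refine h2.congr_deriv ?_
  have h3 : (2 - 2 * Real.cos θ) ^ (α / 2 - 1) * (2 - 2 * Real.cos θ) = rFun α θ := by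
    rw [rFun, ← Real.rpow_add_one hb.ne']
    congr 1
    ring
  have h4 : Real.sin θ * (Real.sin ((k + 1 : ℕ) * θ) - Real.sin (k * θ)) =
      (2 - 2 * Real.cos θ) / 2 * (Real.cos ((k + 1 : ℕ) * θ) + Real.cos (k * θ)) := by
    have h5 : ((k + 1 : ℕ) : ℝ) * θ = k * θ + θ := by push_cast; ring
    rw [h5, Real.sin_add, Real.cos_add]
    linear_combination (Real.cos (k * θ)) * Real.sin_sq_add_cos_sq θ
  have h6 : 2 * Real.sin θ * (α / 2) * (2 - 2 * Real.cos θ) ^ (α / 2 - 1) *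
      (Real.sin ((k + 1 : ℕ) * θ) - Real.sin (k * θ)) =
      α / 2 * rFun α θ * (Real.cos ((k + 1 : ℕ) * θ) + Real.cos (k * θ)) := by
    rw [← h3]
    linear_combination α * (2 - 2 * Real.cos θ) ^ (α / 2 - 1) * h4
  simp only [Pi.sub_apply]
  rw [h6]
  push_cast
  ring

/-- Integrate the preceding derivative over `[-π, π]`: the boundary terms are sines at multiples of
`π`, and the point `0`, where the base of the power vanishes, is an exceptional set for the
fundamental theorem. -/
theorem rCoef_succ {α : ℝ} (hα : 0 < α) (k : ℕ) :
    (k + 1 + α / 2) * rCoef α (k + 1) = (k - α / 2) * rCoef α k := by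
  have hc := continuous_rFun hα.le
  have hi : ∀ m : ℕ, IntervalIntegrable (fun θ => rFun α θ * Real.cos (m * θ)) volume
      (-Real.pi) Real.pi := fun m => Continuous.intervalIntegrable (by fun_prop) _ _
  have h := MeasureTheory.integral_eq_of_hasDerivAt_off_countable
    (fun θ => rFun α θ * (Real.sin ((k + 1 : ℕ) * θ) - Real.sin (k * θ)))
    (fun θ => (k + 1 + α / 2) * (rFun α θ * Real.cos ((k + 1 : ℕ) * θ)) -
        (k - α / 2) * (rFun α θ * Real.cos (k * θ)))
    (a := -Real.pi) (b := Real.pi) (s := {0}) (Set.countable_singleton 0)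
    (Continuous.continuousOn (by fun_prop)) ?_
    (((hi (k + 1)).const_mul _).sub ((hi k).const_mul _))
  · have hpi : ∀ m : ℕ, Real.sin (m * -Real.pi) = 0 := fun m => by
      rw [mul_neg, Real.sin_neg, Real.sin_nat_mul_pi, neg_zero]
    rw [intervalIntegral.integral_sub ((hi (k + 1)).const_mul _) ((hi k).const_mul _),
      intervalIntegral.integral_const_mul, intervalIntegral.integral_const_mul,
      Real.sin_nat_mul_pi, Real.sin_nat_mul_pi, hpi, hpi] at h
    rw [rCoef_eq hα.le, rCoef_eq hα.le]
    linear_combination (1 / (2 * Real.pi)) * h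
  · intro θ hθ
    have hpi := Real.pi_pos
    rw [min_eq_left (by linarith), max_eq_right (by linarith)] at hθ
    refine hasDerivAt_rFun_mul (fun h => hθ.2 ?_) k
    exact (Real.cos_eq_one_iff_of_lt_of_lt (by linarith [hθ.1.1]) (by linarith [hθ.1.2])).1 h

theorem rCoef_zero_pos {α : ℝ} (hα : 0 < α) : 0 < rCoef α 0 := by
  rw [rCoef_eq hα.le]
  have hpi := Real.pi_pos
  refine mul_pos (by positivity) ?_
  refine intervalIntegral.integral_pos (by linarith)
    (Continuous.continuousOn (by have := continuous_rFun hα.le; fun_prop))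
    (fun θ _ => by simpa using rFun_nonneg α θ) ⟨Real.pi, ⟨by linarith, le_rfl⟩, ?_⟩
  simp only [CharP.cast_eq_zero, zero_mul, Real.cos_zero, mul_one, rFun, Real.cos_pi]
  exact Real.rpow_pos_of_pos (by norm_num) _

/-- The recurrence factor `k - α/2` is negative only at `k = 0`, so the sign changes once, from `t_0
> 0` to `t_1 < 0`. -/
theorem rCoef_neg {α : ℝ} (hα : 0 < α) (hα2 : α < 2) {k : ℕ} (hk : 1 ≤ k) : rCoef α k < 0 := by
  induction k, hk using Nat.le_induction with
  | base =>
    have h := rCoef_succ hα 0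
    have := rCoef_zero_pos hα
    simp only [CharP.cast_eq_zero, zero_add, zero_sub] at h
    nlinarith
  | succ k hk ih =>
    have h := rCoef_succ hα k
    have hk' : (1 : ℝ) ≤ k := by exact_mod_cast hk
    have h1 : 0 < (k : ℝ) - α / 2 := by linarith
    by_contra! h2
    have h3 : 0 ≤ (k + 1 + α / 2) * rCoef α (k + 1) := mul_nonneg (by positivity) h2
    nlinarith

theorem rCoef_le_succ {α : ℝ} (hα : 0 < α) (hα2 : α < 2) {k : ℕ} (hk : 1 ≤ k) :
    rCoef α k ≤ rCoef α (k + 1) := by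
  have h := rCoef_succ hα k
  have h1 := rCoef_neg hα hα2 hk
  have h2 : 0 < (k : ℝ) + 1 + α / 2 := by positivity
  refine le_of_mul_le_mul_left ?_ h2
  nlinarith

/-- The recurrence makes the sum telescope. For `N ≥ 1` both factors on the right are negative,
which yields `IsDominantSymbol.sum_pos`. -/
theorem sum_rCoef {α : ℝ} (hα : 0 < α) (N : ℕ) :
    α * (∑ k ∈ Finset.range (N + 1), rCoef α k + ∑ k ∈ Finset.Ico 1 (N + 1), rCoef α k) =
      (α - 2 * N) * rCoef α N := by
  induction N with
  | zero => simp
  | succ N ih =>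
    have h := rCoef_succ hα N
    rw [Finset.sum_range_succ, Finset.sum_Ico_succ_top (by omega)]
    push_cast
    linear_combination ih + 2 * h

theorem isDominantSymbol_rCoef {α : ℝ} (hα : 1 < α) (hα2 : α < 2) :
    IsDominantSymbol (rCoef α) where
  nonpos k hk := (rCoef_neg (by linarith) hα2 hk).le
  mono j k hj hjk := by
    induction k, hjk using Nat.le_induction with
    | base => exact le_rfl
    | succ k hk ih => exact ih.trans (rCoef_le_succ (by linarith) hα2 (hj.trans hk))
  sum_pos n hn := by
    have hα0 : 0 < α := by linarith
    obtain ⟨N, rfl⟩ := Nat.exists_eq_add_of_le' hn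
    have h := sum_rCoef hα0 N
    rcases Nat.eq_zero_or_pos N with rfl | hN
    · simpa using rCoef_zero_pos hα0
    · have h1 := rCoef_neg hα0 hα2 hN
      have hN' : (1 : ℝ) ≤ N := by exact_mod_cast hN
      refine pos_of_mul_pos_left (b := α) ?_ hα0.le
      rw [mul_comm, h]
      exact mul_pos_of_neg_of_neg (by linarith) h1

theorem rFun_le_abs_rpow {α : ℝ} (hα : 0 ≤ α) (θ : ℝ) : rFun α θ ≤ |θ| ^ α := by
  have h : |θ| ^ α = (θ ^ 2) ^ (α / 2) := by
    rw [← sq_abs, ← Real.rpow_natCast, ← Real.rpow_mul (abs_nonneg θ)]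
    congr 1
    push_cast
    ring
  rw [h, rFun]
  refine Real.rpow_le_rpow (two_sub_two_mul_cos_nonneg θ) ?_ (by positivity)
  linarith [Real.one_sub_sq_div_two_le_cos (x := θ)]

theorem abs_rpow_le_rFun {α : ℝ} (hα : 0 ≤ α) (hα2 : α ≤ 2) {θ : ℝ} (hθ : |θ| ≤ Real.pi) :
    |θ| ^ α ≤ Real.pi ^ 2 / 4 * rFun α θ := by
  have hpi := Real.pi_gt_three
  have h : |θ| ^ α = (θ ^ 2) ^ (α / 2) := by
    rw [← sq_abs, ← Real.rpow_natCast, ← Real.rpow_mul (abs_nonneg θ)]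
    congr 1
    push_cast
    ring
  have h1 : θ ^ 2 ≤ Real.pi ^ 2 / 4 * (2 - 2 * Real.cos θ) := by
    have h2 := Real.cos_le_one_sub_mul_cos_sq hθ
    have h3 : 2 / Real.pi ^ 2 * θ ^ 2 * Real.pi ^ 2 = 2 * θ ^ 2 := by field_simp
    nlinarith [sq_nonneg Real.pi]
  have h4 : (1 : ℝ) ≤ Real.pi ^ 2 / 4 := by nlinarith
  rw [h]
  refine (Real.rpow_le_rpow (sq_nonneg θ) h1 (by positivity)).trans ?_
  rw [Real.mul_rpow (by positivity) (two_sub_two_mul_cos_nonneg θ)]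
  refine mul_le_mul_of_nonneg_right ?_ (rFun_nonneg α θ)
  -- Since `π²/4 ≥ 1` and `α/2 ≤ 1`, the constant `(π²/4)^{α/2}` is at most `π²/4`, uniformly in
  -- `α`.
  exact Real.rpow_le_self_of_one_le h4 (by linarith)

end FourierCoefficients

end TauPCG

namespace TauPCG

open Matrix
open scoped Kronecker

/-! ### Definiteness of Kronecker sums -/

section AtLevel

variable {k : ℕ} (n : Fin k → ℕ) (i : Fin k)

/-- Splitting off coordinate `i` turns the matrix into a genuine Kronecker product, from which
definiteness is inherited. -/
theorem atLevel_eq_submatrix (M : Matrix (Fin (n i)) (Fin (n i)) ℝ) :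
    atLevel n i M = (M ⊗ₖ (1 : Matrix ((j : {j // j ≠ i}) → Fin (n j)) _ ℝ)).submatrix
      (Equiv.piSplitAt i fun j => Fin (n j)) (Equiv.piSplitAt i fun j => Fin (n j)) := by
  ext a b
  have h : (∀ j, j ≠ i → a j = b j) ↔
      ((fun j : {j // j ≠ i} => a j) = fun j : {j // j ≠ i} => b j) := by
    rw [funext_iff, Subtype.forall]
  simp [atLevel, Equiv.piSplitAt, one_apply, h]

variable {n i}

theorem posSemidef_atLevel {M : Matrix (Fin (n i)) (Fin (n i)) ℝ} (hM : M.PosSemidef) :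
    (atLevel n i M).PosSemidef := by
  rw [atLevel_eq_submatrix]
  exact (hM.kronecker PosSemidef.one).submatrix _

theorem posDef_atLevel {M : Matrix (Fin (n i)) (Fin (n i)) ℝ} (hM : M.PosDef) :
    (atLevel n i M).PosDef := by
  rw [atLevel_eq_submatrix]
  exact (hM.kronecker PosDef.one).submatrix (Equiv.injective _)

theorem atLevel_sub (M N : Matrix (Fin (n i)) (Fin (n i)) ℝ) :
    atLevel n i (M - N) = atLevel n i M - atLevel n i N := by
  ext a b
  simp only [atLevel, of_apply, Matrix.sub_apply]
  split_ifs <;> simp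

theorem atLevel_smul (c : ℝ) (M : Matrix (Fin (n i)) (Fin (n i)) ℝ) :
    atLevel n i (c • M) = c • atLevel n i M := by
  ext a b
  by_cases h : ∀ j, j ≠ i → a j = b j <;> simp [atLevel, h]

theorem posDef_tauR (hk : 0 < k) {α l : Fin k → ℝ} (hα : ∀ i, 1 < α i ∧ α i < 2)
    (hl : ∀ i, 0 < l i) (n : Fin k → ℕ) : (tauR α l n).PosDef := by
  have : Nonempty (Fin k) := ⟨⟨0, hk⟩⟩
  exact posDef_sum Finset.univ_nonempty fun i _ => posDef_atLevel
    ((isDominantSymbol_rCoef (hα i).1 (hα i).2).posDef_tau.smul (hl i))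

theorem posSemidef_matR_sub {α l : Fin k → ℝ} (hα : ∀ i, 1 < α i ∧ α i < 2)
    (hl : ∀ i, 0 < l i) (n : Fin k → ℕ) : (matR α l n - (1 / 2 : ℝ) • tauR α l n).PosSemidef := by
  rw [matR, tauR, Finset.smul_sum, ← Finset.sum_sub_distrib]
  refine posSemidef_sum _ fun i _ => ?_
  rw [← atLevel_smul, ← atLevel_sub, smul_comm, ← smul_sub]
  exact posSemidef_atLevel
    ((isDominantSymbol_rCoef (hα i).1 (hα i).2).posSemidef_symToeplitz_sub.smul (hl i).le)

theorem posSemidef_sub_matR {α l : Fin k → ℝ} (hα : ∀ i, 1 < α i ∧ α i < 2)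
    (hl : ∀ i, 0 < l i) (n : Fin k → ℕ) : ((3 / 2 : ℝ) • tauR α l n - matR α l n).PosSemidef := by
  rw [matR, tauR, Finset.smul_sum, ← Finset.sum_sub_distrib]
  refine posSemidef_sum _ fun i _ => ?_
  rw [← atLevel_smul, ← atLevel_sub, smul_comm, ← smul_sub]
  exact posSemidef_atLevel
    ((isDominantSymbol_rCoef (hα i).1 (hα i).2).posSemidef_sub_symToeplitz.smul (hl i).le)

end AtLevel

/-! ### Multilevel Toeplitz matrices and their symbols -/

section Toeplitz

variable {k : ℕ} {f g : (Fin k → ℝ) → ℝ}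

theorem isCompact_cube (k : ℕ) : IsCompact (cube k) := isCompact_Icc

theorem re_one_div_two_pi_pow_mul (k : ℕ) (z : ℂ) :
    ((1 / (2 * (Real.pi : ℂ)) ^ k) * z).re = 1 / (2 * Real.pi) ^ k * z.re := by
  rw [show (1 / (2 * (Real.pi : ℂ)) ^ k) = ((1 / (2 * Real.pi) ^ k : ℝ) : ℂ) by push_cast; rfl,
    Complex.re_ofReal_mul]

theorem integrableOn_mul_bounded (hf : IntegrableOn f (cube k)) {w : (Fin k → ℝ) → ℝ}
    (hw : Continuous w) : IntegrableOn (fun θ => f θ * w θ) (cube k) :=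
  hf.mul_continuousOn hw.continuousOn (isCompact_cube k)

theorem toeplitzReal_apply (hf : IntegrableOn f (cube k)) (n : Fin k → ℕ) (a b : MultiIdx n) :
    toeplitzReal f n a b = 1 / (2 * Real.pi) ^ k * ∫ θ in cube k, f θ *
      Real.cos (∑ t, ((a t : ℕ) : ℝ) * θ t - ∑ t, ((b t : ℕ) : ℝ) * θ t) := by
  have hint : IntegrableOn (fun θ : Fin k → ℝ => (f θ : ℂ) * Complex.exp (Complex.I *
      ((∑ t, ((((a t : ℕ) : ℤ) - ((b t : ℕ) : ℤ) : ℤ) : ℝ) * θ t : ℝ) : ℂ))) (cube k) :=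
    IntegrableOn.mul_continuousOn (Integrable.ofReal hf)
      (Continuous.continuousOn (by fun_prop)) (isCompact_cube k)
  have h := Complex.reCLM.integral_comp_comm hint
  simp only [Complex.reCLM_apply] at h
  rw [toeplitzReal, toeplitz, map_apply, of_apply, fourierCoef, re_one_div_two_pi_pow_mul, ← h]
  congr 2
  ext θ
  rw [Complex.re_ofReal_mul, mul_comm Complex.I, Complex.exp_ofReal_mul_I_re]
  congr 2
  rw [← Finset.sum_sub_distrib]
  refine Finset.sum_congr rfl fun t _ => ?_
  push_cast
  ring

theorem toeplitzReal_sub (hf : IntegrableOn f (cube k)) (hg : IntegrableOn g (cube k))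
    (n : Fin k → ℕ) :
    toeplitzReal (f - g) n = toeplitzReal f n - toeplitzReal g n := by
  ext a b
  rw [Matrix.sub_apply, toeplitzReal_apply hf, toeplitzReal_apply hg,
    toeplitzReal_apply (hf.sub hg), ← mul_sub]
  congr 1
  rw [← integral_sub (integrableOn_mul_bounded hf (by fun_prop))
    (integrableOn_mul_bounded hg (by fun_prop))]
  simp only [Pi.sub_apply, sub_mul]

theorem toeplitzReal_const_mul (hf : IntegrableOn f (cube k)) (c : ℝ) (n : Fin k → ℕ) :
    toeplitzReal (fun θ => c * f θ) n = c • toeplitzReal f n := by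
  ext a b
  rw [Matrix.smul_apply, smul_eq_mul, toeplitzReal_apply hf, toeplitzReal_apply (hf.const_mul c),
    mul_left_comm c, ← integral_const_mul c]
  simp only [mul_assoc]

theorem toeplitzReal_sum {ι : Type*} (s : Finset ι) {F : ι → (Fin k → ℝ) → ℝ}
    (hF : ∀ i, IntegrableOn (F i) (cube k)) (n : Fin k → ℕ) :
    toeplitzReal (fun θ => ∑ i ∈ s, F i θ) n = ∑ i ∈ s, toeplitzReal (F i) n := by
  ext a b
  rw [Matrix.sum_apply, toeplitzReal_apply (integrable_finsetSum s fun i _ => hF i)]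
  simp only [fun i => toeplitzReal_apply (hF i) n a b, Finset.sum_mul]
  rw [← Finset.mul_sum, integral_finsetSum]
  exact fun i _ => integrableOn_mul_bounded (hF i) (by fun_prop)

theorem isHermitian_toeplitzReal (hf : IntegrableOn f (cube k)) (n : Fin k → ℕ) :
    (toeplitzReal f n).IsHermitian := by
  ext a b
  rw [conjTranspose_apply, star_trivial, toeplitzReal_apply hf, toeplitzReal_apply hf]
  congr 2
  ext θ
  rw [← Real.cos_neg, neg_sub]

/-- The quadratic form is `(2π)^{-k} ∫ f |∑ x_a e^{ι⟨a,θ⟩}|²`, written out with cosines and sines.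
-/
theorem posSemidef_toeplitzReal (hf : IntegrableOn f (cube k))
    (h0 : ∀ᵐ θ ∂(volume.restrict (cube k)), 0 ≤ f θ) (n : Fin k → ℕ) :
    (toeplitzReal f n).PosSemidef := by
  refine PosSemidef.of_dotProduct_mulVec_nonneg (isHermitian_toeplitzReal hf n) fun x => ?_
  have hw : ∀ a b : MultiIdx n, Continuous fun θ : Fin k → ℝ =>
      Real.cos (∑ t, ((a t : ℕ) : ℝ) * θ t - ∑ t, ((b t : ℕ) : ℝ) * θ t) :=
    fun a b => by fun_prop
  have key : star x ⬝ᵥ (toeplitzReal f n *ᵥ x) = 1 / (2 * Real.pi) ^ k * ∫ θ in cube k,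
      f θ * ((∑ a, x a * Real.cos (∑ t, ((a t : ℕ) : ℝ) * θ t)) ^ 2 +
        (∑ a, x a * Real.sin (∑ t, ((a t : ℕ) : ℝ) * θ t)) ^ 2) := by
    have h1 : ∀ θ : Fin k → ℝ,
        f θ * ((∑ a : MultiIdx n, x a * Real.cos (∑ t, ((a t : ℕ) : ℝ) * θ t)) ^ 2 +
        (∑ a : MultiIdx n, x a * Real.sin (∑ t, ((a t : ℕ) : ℝ) * θ t)) ^ 2) =
        ∑ a : MultiIdx n, ∑ b : MultiIdx n, x a * x b * (f θ *
          Real.cos (∑ t, ((a t : ℕ) : ℝ) * θ t - ∑ t, ((b t : ℕ) : ℝ) * θ t)) := by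
      intro θ
      rw [sq, sq, Finset.sum_mul_sum, Finset.sum_mul_sum, ← Finset.sum_add_distrib,
        Finset.mul_sum]
      refine Finset.sum_congr rfl fun a _ => ?_
      rw [← Finset.sum_add_distrib, Finset.mul_sum]
      refine Finset.sum_congr rfl fun b _ => ?_
      rw [Real.cos_sub]
      ring
    simp only [h1]
    have hi : ∀ a b : MultiIdx n, IntegrableOn (fun θ : Fin k → ℝ => x a * x b * (f θ *
        Real.cos (∑ t, ((a t : ℕ) : ℝ) * θ t - ∑ t, ((b t : ℕ) : ℝ) * θ t))) (cube k) :=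
      fun a b => (integrableOn_mul_bounded hf (hw a b)).const_mul _
    rw [integral_finsetSum _ fun a _ => integrable_finsetSum _ fun b _ => hi a b]
    simp only [integral_finsetSum _ fun b _ => hi _ b, integral_const_mul, dotProduct, mulVec,
      star_trivial, toeplitzReal_apply hf, Finset.mul_sum]
    refine Finset.sum_congr rfl fun a _ => Finset.sum_congr rfl fun b _ => ?_
    ring
  rw [key]
  have hpi := Real.pi_pos
  refine mul_nonneg (by positivity) (integral_nonneg_of_ae ?_)
  filter_upwards [h0] with θ hθ
  exact mul_nonneg hθ (by positivity)

theorem integral_exp_int_mul (m : ℤ) :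
    1 / (2 * (Real.pi : ℂ)) * ∫ x in (-Real.pi)..Real.pi,
      Complex.exp (Complex.I * ((m : ℝ) * x : ℝ)) = if m = 0 then 1 else 0 := by
  have hpi : (Real.pi : ℂ) ≠ 0 := by exact_mod_cast Real.pi_ne_zero
  split_ifs with h
  · subst h
    simp
    field_simp
    ring
  · have hm : Complex.I * m ≠ 0 := mul_ne_zero Complex.I_ne_zero (by exact_mod_cast h)
    have h1 := integral_exp_mul_complex (a := -Real.pi) (b := Real.pi) hm
    have h2 : ∀ x : ℝ, Complex.I * ((m : ℝ) * x : ℝ) = Complex.I * m * x := by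
      intro x; push_cast; ring
    simp only [h2, h1]
    have h3 : Complex.I * m * (Real.pi : ℂ) =
        Complex.I * m * ((-Real.pi : ℝ) : ℂ) + m * (2 * Real.pi * Complex.I) := by
      push_cast; ring
    rw [h3, Complex.exp_add, Complex.exp_int_mul_two_pi_mul_I, mul_one, sub_self, zero_div,
      mul_zero]

/-- The Fourier coefficients of a function of a single coordinate. -/
theorem fourierCoef_comp_eval (i : Fin k) (f : ℝ → ℝ) (j : Fin k → ℤ) :
    fourierCoef (fun θ => f (θ i)) j = if ∀ t, t ≠ i → j t = 0 then
      1 / (2 * (Real.pi : ℂ)) * ∫ x in (-Real.pi)..Real.pi,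
        (f x : ℂ) * Complex.exp (Complex.I * ((j i : ℝ) * x : ℝ)) else 0 := by
  have hpi := Real.pi_pos
  -- The integrand is a product over coordinates, so the integral factors; every coordinate other
  -- than `i` contributes a Kronecker delta.
  set G : Fin k → ℝ → ℂ := fun t x =>
    (if t = i then (f x : ℂ) else 1) * Complex.exp (Complex.I * ((j t : ℝ) * x : ℝ)) with hG
  have h1 : ∀ θ : Fin k → ℝ, (f (θ i) : ℂ) *
      Complex.exp (Complex.I * ((∑ t, (j t : ℝ) * θ t : ℝ) : ℂ)) = ∏ t, G t (θ t) := by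
    intro θ
    rw [hG, Finset.prod_mul_distrib, Finset.prod_ite_eq' Finset.univ i fun t => (f (θ t) : ℂ),
      if_pos (Finset.mem_univ i), ← Complex.exp_sum, ← Finset.mul_sum]
    push_cast
    rfl
  have h2 : (volume : Measure (Fin k → ℝ)).restrict (cube k) =
      Measure.pi fun _ => volume.restrict (Set.Icc (-Real.pi) Real.pi) := by
    rw [cube, ← Set.pi_univ_Icc, volume_pi, Measure.restrict_pi_pi]
  have h3 : fourierCoef (fun θ => f (θ i)) j =
      ∏ t, (1 / (2 * (Real.pi : ℂ)) * ∫ x in (-Real.pi)..Real.pi, G t x) := by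
    rw [fourierCoef]
    simp only [h1]
    rw [h2, integral_fintype_prod_eq_prod, Finset.prod_mul_distrib, Finset.prod_const,
      Finset.card_univ, Fintype.card_fin, div_pow, one_pow]
    congr 1
    refine Finset.prod_congr rfl fun t _ => ?_
    rw [intervalIntegral.integral_of_le (by linarith), integral_Icc_eq_integral_Ioc]
  have h4 : ∀ t, t ≠ i → 1 / (2 * (Real.pi : ℂ)) * ∫ x in (-Real.pi)..Real.pi, G t x =
      if j t = 0 then 1 else 0 := by
    intro t ht
    rw [← integral_exp_int_mul]
    simp only [hG, if_neg ht, one_mul]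
  rw [h3]
  split_ifs with h
  · rw [Finset.prod_eq_single i (fun t _ ht => by rw [h4 t ht, if_pos (h t ht)])
      (fun hi => absurd (Finset.mem_univ i) hi)]
    simp only [hG, if_true]
  · push Not at h
    obtain ⟨t, ht, hjt⟩ := h
    exact Finset.prod_eq_zero (Finset.mem_univ t) (by rw [h4 t ht, if_neg hjt])

theorem re_integral_rFun_mul_exp {α : ℝ} (hα : 0 ≤ α) (m : ℤ) :
    (1 / (2 * (Real.pi : ℂ)) * ∫ x in (-Real.pi)..Real.pi,
      (rFun α x : ℂ) * Complex.exp (Complex.I * ((m : ℝ) * x : ℝ))).re = rCoef α m.natAbs := by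
  have hint : IntervalIntegrable (fun θ : ℝ => (rFun α θ : ℂ) *
      Complex.exp (Complex.I * (((m : ℝ) * θ : ℝ) : ℂ))) volume (-Real.pi) Real.pi := by
    have := continuous_rFun hα
    exact Continuous.intervalIntegrable (by fun_prop) _ _
  have hre := re_one_div_two_pi_pow_mul 1
  simp only [pow_one] at hre
  have h := Complex.reCLM.intervalIntegral_comp_comm hint
  rw [Complex.reCLM_apply] at h
  rw [hre, ← h, rCoef_eq hα]
  congr 2
  ext θ
  rw [Complex.reCLM_apply, Complex.re_ofReal_mul, mul_comm Complex.I, Complex.exp_ofReal_mul_I_re]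
  congr 1
  rcases Int.natAbs_eq m with hm | hm
  · conv_lhs => rw [hm]
    simp
  · conv_lhs => rw [hm]
    simp

theorem continuous_rFun_eval {α : ℝ} (hα : 0 ≤ α) (i : Fin k) :
    Continuous fun θ : Fin k → ℝ => rFun α (θ i) :=
  (continuous_rFun hα).comp (continuous_apply i)

theorem continuous_sum_rFun {α : Fin k → ℝ} (l : Fin k → ℝ) (hα : ∀ i, 0 ≤ α i) :
    Continuous fun θ : Fin k → ℝ => ∑ i, l i * rFun (α i) (θ i) :=
  continuous_finsetSum _ fun i _ => (continuous_rFun_eval (hα i) i).const_mul (l i)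

/-- This identifies `R_n` as a Toeplitz matrix, so that inequalities between symbols apply to it;
the deltas in the other coordinates are the identity factors. -/
theorem toeplitzReal_sum_rFun {α : Fin k → ℝ} (l : Fin k → ℝ) (hα : ∀ i, 0 ≤ α i)
    (n : Fin k → ℕ) :
    toeplitzReal (fun θ => ∑ i, l i * rFun (α i) (θ i)) n = matR α l n := by
  have hi : ∀ i, IntegrableOn (fun θ : Fin k → ℝ => rFun (α i) (θ i)) (cube k) := fun i =>
    (continuous_rFun_eval (hα i) i).continuousOn.integrableOn_compact (isCompact_cube k)
  rw [toeplitzReal_sum _ (fun i => (hi i).const_mul (l i)), matR]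
  refine Finset.sum_congr rfl fun i _ => ?_
  rw [toeplitzReal_const_mul (hi i), atLevel_smul]
  congr 1
  ext a b
  have hiff : (∀ t, t ≠ i → ((a t : ℕ) : ℤ) - ((b t : ℕ) : ℤ) = 0) ↔ ∀ t, t ≠ i → a t = b t := by
    refine forall₂_congr fun t _ => ?_
    rw [sub_eq_zero, Nat.cast_inj, Fin.ext_iff]
  rw [toeplitzReal, toeplitz, map_apply, of_apply, fourierCoef_comp_eval, atLevel, of_apply]
  simp only [hiff]
  split_ifs
  · exact re_integral_rFun_mul_exp (hα i) _
  · rfl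

end Toeplitz

/-! ### Comparison of `T_n(p)` with the preconditioner -/

section Comparison

variable {k : ℕ} {α l : Fin k → ℝ}

theorem qFun_nonneg (hl : ∀ i, 0 < l i) (θ : Fin k → ℝ) : 0 ≤ qFun α l θ :=
  Finset.sum_nonneg fun i _ => mul_nonneg (hl i).le (Real.rpow_nonneg (abs_nonneg _) _)

theorem sum_rFun_le_qFun (hα : ∀ i, 1 < α i ∧ α i < 2) (hl : ∀ i, 0 < l i) (θ : Fin k → ℝ) :
    ∑ i, l i * rFun (α i) (θ i) ≤ qFun α l θ :=
  Finset.sum_le_sum fun i _ => mul_le_mul_of_nonneg_left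
    (rFun_le_abs_rpow (by linarith [(hα i).1]) _) (hl i).le

theorem qFun_le_sum_rFun (hα : ∀ i, 1 < α i ∧ α i < 2) (hl : ∀ i, 0 < l i) {θ : Fin k → ℝ}
    (hθ : θ ∈ cube k) :
    qFun α l θ ≤ Real.pi ^ 2 / 4 * ∑ i, l i * rFun (α i) (θ i) := by
  rw [Finset.mul_sum]
  refine Finset.sum_le_sum fun i _ => ?_
  rw [mul_left_comm]
  exact mul_le_mul_of_nonneg_left (abs_rpow_le_rFun (by linarith [(hα i).1]) (hα i).2.le
    (abs_le.2 ⟨hθ.1 i, hθ.2 i⟩)) (hl i).le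

/-- As `x / 0 = 0`, a positive lower bound on the quotient already excludes a zero denominator. -/
theorem le_of_le_div_of_pos {c x y : ℝ} (hc : 0 < c) (hy : 0 ≤ y) (h : c ≤ x / y) :
    0 < y ∧ c * y ≤ x := by
  rcases hy.eq_or_lt with rfl | hy
  · rw [div_zero] at h
    linarith
  · exact ⟨hy, (le_div_iff₀ hy).1 h⟩

/-- The forms of `T_n(p)` and of the `τ` preconditioner are equivalent, with constants that do not
depend on the size. -/
theorem tauR_le_toeplitzReal_le (hα : ∀ i, 1 < α i ∧ α i < 2) (hl : ∀ i, 0 < l i)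
    {p : (Fin k → ℝ) → ℝ} (hp : IntegrableOn p (cube k)) {c₀ c₁ : ℝ} (hc₀ : 0 < c₀)
    (hc₁ : 0 ≤ c₁)
    (hpq : ∀ᵐ θ ∂(volume.restrict (cube k)),
      c₀ ≤ p θ / qFun α l θ ∧ p θ / qFun α l θ ≤ c₁) (n : Fin k → ℕ) (x : MultiIdx n → ℝ) :
    c₀ / 2 * (x ⬝ᵥ (tauR α l n *ᵥ x)) ≤ x ⬝ᵥ (toeplitzReal p n *ᵥ x) ∧
    x ⬝ᵥ (toeplitzReal p n *ᵥ x) ≤ 3 * Real.pi ^ 2 / 8 * c₁ * (x ⬝ᵥ (tauR α l n *ᵥ x)) := by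
  have hα0 : ∀ i, 0 ≤ α i := fun i => by linarith [(hα i).1]
  have hr : IntegrableOn (fun θ : Fin k → ℝ => ∑ i, l i * rFun (α i) (θ i)) (cube k) :=
    (continuous_sum_rFun l hα0).continuousOn.integrableOn_compact (isCompact_cube k)
  have hR := toeplitzReal_sum_rFun l hα0 n
  have hcube : ∀ᵐ θ ∂(volume.restrict (cube k)), θ ∈ cube k :=
    ae_restrict_mem (isCompact_cube k).measurableSet
  have h1 := posSemidef_toeplitzReal (hp.sub (hr.const_mul c₀)) (by
    filter_upwards [hpq] with θ hθ
    have h := (le_of_le_div_of_pos hc₀ (qFun_nonneg hl θ) hθ.1).2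
    have h' := mul_le_mul_of_nonneg_left (sum_rFun_le_qFun hα hl θ) hc₀.le
    exact sub_nonneg.2 (h'.trans h)) n
  have h2 := posSemidef_toeplitzReal ((hr.const_mul (Real.pi ^ 2 / 4 * c₁)).sub hp) (by
    filter_upwards [hpq, hcube] with θ hθ hθc
    have h := (le_of_le_div_of_pos hc₀ (qFun_nonneg hl θ) hθ.1).1
    have h' := (div_le_iff₀ h).1 hθ.2
    have h'' := mul_le_mul_of_nonneg_left (qFun_le_sum_rFun hα hl hθc) hc₁
    refine sub_nonneg.2 (h'.trans (h''.trans (le_of_eq ?_)))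
    ring) n
  have e1 := dotProduct_mulVec_nonneg h1 x
  have e2 := dotProduct_mulVec_nonneg h2 x
  have e3 := dotProduct_mulVec_nonneg (posSemidef_matR_sub hα hl n) x
  have e4 := dotProduct_mulVec_nonneg (posSemidef_sub_matR hα hl n) x
  rw [toeplitzReal_sub hp (hr.const_mul c₀), toeplitzReal_const_mul hr, hR] at e1
  rw [toeplitzReal_sub (hr.const_mul _) hp, toeplitzReal_const_mul hr, hR] at e2
  simp only [sub_mulVec, smul_mulVec, dotProduct_sub, dotProduct_smul, smul_eq_mul] at e1 e2 e3 e4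
  constructor
  -- The constants come from the chains `B ≥ c₀ R ≥ (c₀/2) τ(R)` and `B ≤ (π²/4) c₁ R ≤ (π²/4)(3/2)
  -- c₁ τ(R)`.
  · have := mul_nonneg hc₀.le e3
    linarith
  · have := mul_nonneg (mul_nonneg (by positivity : 0 ≤ Real.pi ^ 2 / 4) hc₁) e4
    linarith

theorem posDef_toeplitzReal (hk : 0 < k) (hα : ∀ i, 1 < α i ∧ α i < 2) (hl : ∀ i, 0 < l i)
    {p : (Fin k → ℝ) → ℝ} (hp : IntegrableOn p (cube k)) {c₀ c₁ : ℝ} (hc₀ : 0 < c₀)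
    (hc₁ : 0 ≤ c₁)
    (hpq : ∀ᵐ θ ∂(volume.restrict (cube k)),
      c₀ ≤ p θ / qFun α l θ ∧ p θ / qFun α l θ ≤ c₁) (n : Fin k → ℕ) :
    (toeplitzReal p n).PosDef := by
  refine PosDef.of_dotProduct_mulVec_pos (isHermitian_toeplitzReal hp n) fun x hx => ?_
  rw [star_trivial]
  exact (mul_pos (half_pos hc₀) (dotProduct_mulVec_pos (posDef_tauR hk hα hl n) hx)).trans_le
    (tauR_le_toeplitzReal_le hα hl hp hc₀ hc₁ hpq n x).1

end Comparison

end TauPCG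

/-! ### The condition number and iteration bounds -/

theorem mainTheorem6 (k : ℕ) (hk : 0 < k) (α l : Fin k → ℝ)
    (hα : ∀ i, 1 < α i ∧ α i < 2) (hl : ∀ i, 0 < l i)
    (p : (Fin k → ℝ) → ℝ)
    (hp_int : MeasureTheory.IntegrableOn p (TauPCG.cube k))
    (hp_nonneg : ∀ᵐ θ ∂(MeasureTheory.volume.restrict (TauPCG.cube k)), 0 ≤ p θ)
    (hp_even : ∀ᵐ θ ∂(MeasureTheory.volume.restrict (TauPCG.cube k)), p (-θ) = p θ)
    (hp_zero : p 0 = 0)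
    (c₀ c₁ : ℝ) (hc₀ : 0 < c₀) (hc : c₀ < c₁)
    (hpq : ∀ᵐ θ ∂(MeasureTheory.volume.restrict (TauPCG.cube k)),
      c₀ ≤ p θ / TauPCG.qFun α l θ ∧ p θ / TauPCG.qFun α l θ ≤ c₁) :
    (∀ n : Fin k → ℕ, (∀ i, 0 < n i) →
      (TauPCG.tauR α l n).PosDef ∧
      (TauPCG.toeplitzReal p n).PosDef ∧
      (∀ μ ∈ spectrum ℂ
          (((TauPCG.tauR α l n)⁻¹ * TauPCG.toeplitzReal p n).map (fun x : ℝ => (x : ℂ))),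
        0 < μ.re ∧ μ.im = 0) ∧
      TauPCG.specCond ((TauPCG.tauR α l n)⁻¹ * TauPCG.toeplitzReal p n)
        ≤ 3 * Real.pi ^ 2 * c₁ / c₀) ∧
    (∀ ε : ℝ, 0 < ε → ∃ M : ℕ, ∀ n : Fin k → ℕ, (∀ i, 0 < n i) →
      ∀ b u x₀ : TauPCG.MultiIdx n → ℝ, (TauPCG.toeplitzReal p n).mulVec u = b →
      ∀ m : ℕ, M ≤ m →
        TauPCG.energyNorm (TauPCG.toeplitzReal p n)
            (TauPCG.pcgIterate (TauPCG.toeplitzReal p n) (TauPCG.tauR α l n) b x₀ m - u)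
          ≤ ε * TauPCG.energyNorm (TauPCG.toeplitzReal p n) (x₀ - u)) := by

  have hc₁ : 0 < c₁ := hc₀.trans hc
  have hpi := Real.pi_gt_three
  have hab : c₀ / 2 ≤ 3 * Real.pi ^ 2 / 8 * c₁ := by
    have : 9 * c₁ ≤ Real.pi ^ 2 * c₁ := mul_le_mul_of_nonneg_right (by nlinarith) hc₁.le
    linarith
  have hP := TauPCG.posDef_tauR hk hα hl
  have hA := TauPCG.posDef_toeplitzReal hk hα hl hp_int hc₀ hc₁.le hpq
  have hbd := TauPCG.tauR_le_toeplitzReal_le hα hl hp_int hc₀ hc₁.le hpq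
  refine ⟨fun n _ => ⟨hP n, hA n, fun μ hμ => ?_, ?_⟩, fun ε hε => ?_⟩
  · have h := TauPCG.spectrum_inv_mul (hA n).isHermitian (hP n) (fun x => (hbd n x).1)
      (fun x => (hbd n x).2) hμ
    exact ⟨(half_pos hc₀).trans_le h.1.1, h.2⟩
  · refine (TauPCG.specCond_inv_mul_le (hA n).isHermitian (hP n) (half_pos hc₀) (by positivity)
      (fun x => (hbd n x).1) (fun x => (hbd n x).2)).trans ?_
    -- The quotient of the two form constants is `3π²c₁ / (4c₀)`, a quarter of the claimed bound.
    rw [div_le_div_iff₀ (half_pos hc₀) hc₀]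
    have : 0 ≤ Real.pi ^ 2 * c₁ * c₀ := by positivity
    linarith
  · obtain ⟨M, hM⟩ := TauPCG.exists_forall_energyNorm_pcgIterate_le (half_pos hc₀) hab hε
    refine ⟨M, fun n _ b u x₀ hu m hm => ?_⟩
    subst hu
    exact hM (hA n) (hP n) (fun x => (hbd n x).1) (fun x => (hbd n x).2) u x₀ m hm
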